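/- Let $\varepsilon>0$. There is a constant $C_\varepsilon>0$, depending only on $\varepsilon$, with the following property. Let $d\ge 1$ be a squarefree integer, let $\mathscr{H}_d=\{\mathbf{x}=(x,y,z)\in\mathbb{Z}^3 : x^2+y^2+z^2=d\}$, and let $e\in\mathbb{Z}$ satisfy $|e|<d$. Then the number of pairs $(\mathbf{x}_1,\mathbf{x}_2)\in\mathscr{H}_d^2$ with dot product $\mathbf{x}_1\cdot\mathbf{x}_2=e$ is finite and at most $C_\varepsilon d^{\varepsilon}$. Equivalently, the number of representations of the binary quadratic form $R(x,y)=dx^2+2exy+dy^2$ by the ternary form $Q(x,y,z)=x^2+y^2+z^2$, i.e. of $\mathbb{Z}$-linear maps $\iota:\mathbb{Z}^2\to\mathbb{Z}^3$ with $Q(\iota(v))=R(v)$ for all $v\in\mathbb{Z}^2$, is finite and at most $C_\varepsilon d^{\varepsilon}$; indeed this number is equal to the number of such pairs $(\mathbf{x}_1,\mathbf{x}_2)$. -/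

import Mathlib

open scoped Matrix

/-- The set of integer points on the sphere `x² + y² + z² = d`. -/
def integerSphere (d : ℤ) : Set (Fin 3 → ℤ) := {x | x 0 ^ 2 + x 1 ^ 2 + x 2 ^ 2 = d}

/-- The pairs of integer points on the sphere `x² + y² + z² = d` whose dot product is `e`. -/
def spherePairs (d e : ℤ) : Set ((Fin 3 → ℤ) × (Fin 3 → ℤ)) :=
  {p | p.1 ∈ integerSphere d ∧ p.2 ∈ integerSphere d ∧ p.1 ⬝ᵥ p.2 = e}

/-- The binary quadratic form `a x² + b x y + c y²` on `ℤ²`. -/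
def binaryForm (a b c : ℤ) : QuadraticForm ℤ (Fin 2 → ℤ) :=
  a • QuadraticMap.proj 0 0 + b • QuadraticMap.proj 0 1 + c • QuadraticMap.proj 1 1

/-- The ternary quadratic form `x² + y² + z²` on `ℤ³`. -/
def sumThreeSquares : QuadraticForm ℤ (Fin 3 → ℤ) :=
  QuadraticMap.proj 0 0 + QuadraticMap.proj 1 1 + QuadraticMap.proj 2 2

/-- A representation of an integral quadratic form `R` on `ℤⁿ` by an integral quadratic form `Q`
on `ℤᵐ` is a `ℤ`-linear map `ι : ℤⁿ → ℤᵐ` such that `Q (ι v) = R v` for all `v`. -/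
abbrev FormRepresentation {m n : ℕ} (R : QuadraticForm ℤ (Fin n → ℤ))
    (Q : QuadraticForm ℤ (Fin m → ℤ)) : Type :=
  QuadraticMap.Isometry R Q

/-! ### The divisor bound -/

/-! Each pair `(x, x')` is encoded, up to boundedly many choices, by four integers, each ranging
over divisors or square roots modulo an integer. As `d` is squarefree, `x` is primitive, so `x' = h
x + k w` with `x, w, z` an oriented basis of `ℤ³`. Put `f = x·w`, `a = x·z`, `D = d|w|² - f²`, `n =
d(w·z) - fa`. Then `k² D = d² - e²`, and Gram determinant 1 gives `n² + d = D(d|z|² - a²)`. Hence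
`f² ≡ -D` mod `d`, `n² ≡ -d` mod `D` and `a² ≡ -(n² + d)/D` mod `d`; changing the basis reduces `f`,
`n`, `a` to residues (`exists_hasInvariants`). Squarefreeness of `d` keeps each root count within
twice a number of divisors (`card_sqrtsOfNeg_le`). Finally `(k, f, n, a)` fixes the Gram matrix, so
pairs sharing it differ by an integral orthogonal matrix (`HasInvariants.exists_smallMatrix`). -/

theorem Nat.exists_card_divisors_le_mul_rpow (ε : ℝ) (hε : 0 < ε) :
    ∃ C : ℝ, 1 ≤ C ∧ ∀ n : ℕ, n ≠ 0 → (n.divisors.card : ℝ) ≤ C * (n : ℝ) ^ ε := by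
  set L : ℝ := ε * Real.log 2 with hL
  have hL0 : 0 < L := mul_pos hε (Real.log_pos one_lt_two)
  set K : ℝ := 1 + 1 / L with hK
  have hK1 : 1 ≤ K := le_add_of_nonneg_right (by positivity)
  -- Primes `p ≥ P` have `p ^ ε ≥ 2`, so they satisfy `a + 1 ≤ p ^ (ε a)` at no cost; each of the
  -- fewer than `P + 1` smaller ones costs a factor `K`.
  set P : ℕ := ⌈(2 : ℝ) ^ (1 / ε)⌉₊ with hP
  refine ⟨K ^ P, one_le_pow₀ hK1, fun n hn => ?_⟩
  have hpow (p a : ℕ) : ((p : ℝ) ^ a) ^ ε = ((p : ℝ) ^ ε) ^ a := by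
    rw [← Real.rpow_natCast_mul p.cast_nonneg, mul_comm, Real.rpow_mul_natCast p.cast_nonneg]
  have key : ∀ p ∈ n.primeFactors, ((n.factorization p + 1 : ℕ) : ℝ) ≤
      (if p < P then K else 1) * ((p : ℝ) ^ n.factorization p) ^ ε := by
    intro p hp
    have hp2 : (2 : ℝ) ≤ p := by exact_mod_cast (Nat.prime_of_mem_primeFactors hp).two_le
    set a := n.factorization p
    rw [hpow]
    split_ifs with h
    · have h1 : (1 : ℝ) + a * L ≤ ((p : ℝ) ^ ε) ^ a := by
        have h2 : 1 + (a : ℝ) * L ≤ Real.exp (a * L) := by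
          linarith [Real.add_one_le_exp ((a : ℝ) * L)]
        have h3 : Real.exp (a * L) = ((2 : ℝ) ^ ε) ^ a := by
          rw [Real.exp_nat_mul, Real.rpow_def_of_pos two_pos, hL, mul_comm ε]
        rw [h3] at h2
        refine h2.trans ?_
        gcongr
      calc ((a + 1 : ℕ) : ℝ) ≤ K * (1 + a * L) := by
            have : K * (1 + a * L) = 1 + a + a * L + 1 / L := by rw [hK]; field_simp; ring
            rw [this]; push_cast
            have : 0 ≤ (a : ℝ) * L := by positivity
            have : 0 ≤ 1 / L := by positivity
            linarith
        _ ≤ _ := by gcongr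
    · have h1 : (2 : ℝ) ≤ (p : ℝ) ^ ε := by
        have h2 : (2 : ℝ) ^ (1 / ε) ≤ p := Nat.ceil_le.1 (not_lt.1 h)
        have h3 := Real.rpow_le_rpow (by positivity) h2 hε.le
        rwa [← Real.rpow_mul two_pos.le, one_div_mul_cancel hε.ne', Real.rpow_one] at h3
      rw [one_mul]
      calc ((a + 1 : ℕ) : ℝ) ≤ (2 : ℝ) ^ a := by exact_mod_cast Nat.lt_two_pow_self
        _ ≤ _ := by gcongr
  rw [Nat.card_divisors hn, Nat.cast_prod]
  refine (Finset.prod_le_prod (fun _ _ => Nat.cast_nonneg _) key).trans ?_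
  rw [Finset.prod_mul_distrib]
  have hn' : ∏ p ∈ n.primeFactors, ((p : ℝ) ^ n.factorization p) ^ ε = (n : ℝ) ^ ε := by
    rw [Real.finsetProd_rpow _ _ fun _ _ => by positivity]
    congr 1
    conv_rhs => rw [← Nat.prod_factorization_pow_eq_self hn]
    rw [Finsupp.prod, Nat.support_factorization]
    push_cast
    rfl
  rw [hn']
  gcongr
  rw [Finset.prod_ite, Finset.prod_const, Finset.prod_const_one, mul_one]
  refine pow_le_pow_right₀ hK1 ?_
  refine (Finset.card_le_card (t := Finset.range P) fun p hp => ?_).trans_eq (Finset.card_range P)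
  exact Finset.mem_range.2 (Finset.mem_filter.1 hp).2

/-! ### Square roots modulo an integer -/

/-- The residues `0 ≤ n < m` with `n ^ 2 ≡ -a` modulo `m`. -/
noncomputable def sqrtsOfNeg (m a : ℤ) : Finset ℤ := {n ∈ Finset.Ico 0 m | m ∣ n ^ 2 + a}

theorem mem_sqrtsOfNeg {m a n : ℤ} :
    n ∈ sqrtsOfNeg m a ↔ (0 ≤ n ∧ n < m) ∧ m ∣ n ^ 2 + a := by
  simp [sqrtsOfNeg]

/-- If `b² ∣ m` and `b ∣ r`, then `b² ∣ a`, so `b` is a unit. Apply this to `b = c / 2` for even `c`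
and to `c` itself for odd `c`. -/
theorem dvd_two_of_dvd_two_mul {m a c r : ℤ} (hm : ∀ c : ℤ, c ^ 2 ∣ m → c ^ 2 ∣ a → IsUnit c)
    (hr : m ∣ r ^ 2 + a) (hcm : c ^ 2 ∣ m) (hc : c ∣ 2 * r) : c ∣ 2 := by
  have key : ∀ b : ℤ, b ^ 2 ∣ m → b ∣ r → IsUnit b := fun b hb hbr =>
    hm b hb ((dvd_add_right (pow_dvd_pow_of_dvd hbr 2)).1 (hb.trans hr))
  rcases Int.even_or_odd' c with ⟨b, rfl | hb⟩
  · have hbr : b ∣ r := (mul_dvd_mul_iff_left two_ne_zero).1 hc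
    have hbm : b ^ 2 ∣ m := (pow_dvd_pow_of_dvd (Dvd.intro_left 2 rfl) 2).trans hcm
    obtain h | h := Int.isUnit_iff.1 (key b hbm hbr) <;> simp [h]
  · have hco : IsCoprime c 2 := ⟨1, -b, by rw [hb]; ring⟩
    exact (key c hcm (hco.dvd_of_dvd_mul_left hc)).dvd

/-- With `g` the common gcd and `m = g q`, the congruence `(s - r)(s + r) ≡ 0` forces `q ∣ s + r`,
and likewise for `t`. So `g` and `q` both divide `s - t`, and their gcd divides `2r`, hence 2. -/
theorem dvd_two_mul_sub_of_gcd_eq {m a r s t : ℤ} (hm0 : 0 < m)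
    (hm : ∀ c : ℤ, c ^ 2 ∣ m → c ^ 2 ∣ a → IsUnit c)
    (hr : m ∣ r ^ 2 + a) (hs : m ∣ s ^ 2 + a) (ht : m ∣ t ^ 2 + a)
    (hst : Int.gcd (s - r) m = Int.gcd (t - r) m) : m ∣ 2 * (s - t) := by
  obtain ⟨g, hg⟩ : ∃ g : ℤ, g = Int.gcd (s - r) m := ⟨_, rfl⟩
  have hg0 : g ≠ 0 := by
    rw [hg]
    exact_mod_cast (Int.gcd_pos_of_ne_zero_right _ hm0.ne').ne'
  obtain ⟨q, hq⟩ : g ∣ m := hg ▸ Int.gcd_dvd_right _ _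
  have key : ∀ u : ℤ, m ∣ u ^ 2 + a → g = Int.gcd (u - r) m → g ∣ u - r ∧ q ∣ u + r := by
    intro u hu hgu
    have h1 : g ∣ u - r := hgu ▸ Int.gcd_dvd_left _ _
    refine ⟨h1, ?_⟩
    obtain ⟨v, hv⟩ := h1
    have hco : IsCoprime q v := by
      have hb := Int.gcd_eq_gcd_ab (u - r) m
      rw [← hgu] at hb
      refine ⟨Int.gcdB (u - r) m, Int.gcdA (u - r) m, mul_left_cancel₀ hg0 ?_⟩
      calc _ = g * v * Int.gcdA (u - r) m + g * q * Int.gcdB (u - r) m := by ring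
        _ = g := by rw [← hv, ← hq]; exact hb.symm
        _ = g * 1 := by ring
    refine hco.dvd_of_dvd_mul_left ?_
    have h2 : m ∣ (u - r) * (u + r) := by
      have := dvd_sub hu hr
      rwa [show u ^ 2 + a - (r ^ 2 + a) = (u - r) * (u + r) by ring] at this
    rwa [hq, hv, mul_assoc, mul_dvd_mul_iff_left hg0] at h2
  obtain ⟨hs1, hs2⟩ := key s hs hg
  obtain ⟨ht1, ht2⟩ := key t ht (by rw [hg, hst])
  have hg1 : g ∣ s - t := by
    have := dvd_sub hs1 ht1
    rwa [sub_sub_sub_cancel_right] at this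
  have hq1 : q ∣ s - t := by
    have := dvd_sub hs2 ht2
    rwa [add_sub_add_right_eq_sub] at this
  have hc2 : (Int.gcd g q : ℤ) ∣ 2 := by
    refine dvd_two_of_dvd_two_mul hm hr ?_ (r := r) ?_
    · rw [hq, sq]
      exact mul_dvd_mul (Int.gcd_dvd_left _ _) (Int.gcd_dvd_right _ _)
    · have := dvd_sub ((Int.gcd_dvd_right g q).trans hs2) ((Int.gcd_dvd_left g q).trans hs1)
      rwa [show s + r - (s - r) = 2 * r by ring] at this
  obtain ⟨w, hw⟩ := hc2
  obtain ⟨x, hx⟩ := hg1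
  obtain ⟨y, hy⟩ := hq1
  refine ⟨w * (Int.gcdA g q * y + Int.gcdB g q * x), ?_⟩
  rw [hw, Int.gcd_eq_gcd_ab, hq]
  linear_combination w * g * Int.gcdA g q * hy + w * q * Int.gcdB g q * hx

theorem card_sqrtsOfNeg_le {m a : ℤ} (hm0 : 0 < m)
    (hm : ∀ c : ℤ, c ^ 2 ∣ m → c ^ 2 ∣ a → IsUnit c) :
    (sqrtsOfNeg m a).card ≤ 2 * m.natAbs.divisors.card := by
  rcases (sqrtsOfNeg m a).eq_empty_or_nonempty with h | ⟨r, hr⟩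
  · simp [h]
  have hr' := (mem_sqrtsOfNeg.1 hr).2
  have hcard : (m.natAbs.divisors ×ˢ (Finset.univ : Finset Bool)).card =
      2 * m.natAbs.divisors.card := by
    simp [Finset.card_product, mul_comm]
  rw [← hcard]
  refine Finset.card_le_card_of_injOn (fun n => (Int.gcd (n - r) m, decide (2 * n < m))) ?_ ?_
  · intro n _
    simp only [Finset.coe_product, Finset.coe_univ, Set.mem_prod, Set.mem_univ, and_true,
      Finset.mem_coe, Nat.mem_divisors]
    exact ⟨by simpa using Int.natAbs_dvd_natAbs.2 (Int.gcd_dvd_right (n - r) m), by simpa using hm0.ne'⟩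
  · intro s hs t ht hst
    obtain ⟨⟨hs0, hs1⟩, hs2⟩ := mem_sqrtsOfNeg.1 hs
    obtain ⟨⟨ht0, ht1⟩, ht2⟩ := mem_sqrtsOfNeg.1 ht
    simp only [Prod.mk.injEq, decide_eq_decide] at hst
    have h := dvd_two_mul_sub_of_gcd_eq hm0 hm hr' hs2 ht2 hst.1
    -- Both roots lie in the same half of `[0, m)`, so `|2(s - t)| < m`.
    have h0 := Int.eq_zero_of_abs_lt_dvd h (by rw [abs_lt]; by_cases 2 * s < m <;> constructor <;> omega)
    omega

/-! ### Bases of `ℤ³` adapted to a pair of vectors -/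

theorem exists_pos_smul_dotProduct_eq_one {v : Fin 3 → ℤ} (hv : v ≠ 0) :
    ∃ (k : ℤ) (m z : Fin 3 → ℤ), 0 < k ∧ v = k • m ∧ m ⬝ᵥ z = 1 := by
  set g : ℤ := ((Int.gcd (v 0) (v 1) : ℕ) : ℤ) with hg
  set k : ℤ := ((Int.gcd g (v 2) : ℕ) : ℤ) with hk
  have hk0 : k ≠ 0 := by
    intro h
    have h1 := Int.gcd_eq_zero_iff.1 (Int.natCast_eq_zero.1 h)
    have h2 := Int.gcd_eq_zero_iff.1 (Int.natCast_eq_zero.1 h1.1)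
    exact hv (by ext i; fin_cases i <;> simp [h1.2, h2.1, h2.2])
  have hkg : k ∣ g := Int.gcd_dvd_left _ _
  obtain ⟨m0, h0⟩ : k ∣ v 0 := hkg.trans (Int.gcd_dvd_left _ _)
  obtain ⟨m1, h1⟩ : k ∣ v 1 := hkg.trans (Int.gcd_dvd_right _ _)
  obtain ⟨m2, h2⟩ : k ∣ v 2 := Int.gcd_dvd_right _ _
  refine ⟨k, ![m0, m1, m2], ![Int.gcdA (v 0) (v 1) * Int.gcdA g (v 2),
    Int.gcdB (v 0) (v 1) * Int.gcdA g (v 2), Int.gcdB g (v 2)],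
    lt_of_le_of_ne (Int.natCast_nonneg _) hk0.symm, ?_, ?_⟩
  · ext i
    fin_cases i <;> simp [h0, h1, h2]
  · have e1 : g = v 0 * Int.gcdA (v 0) (v 1) + v 1 * Int.gcdB (v 0) (v 1) := Int.gcd_eq_gcd_ab _ _
    have e2 : k = g * Int.gcdA g (v 2) + v 2 * Int.gcdB g (v 2) := Int.gcd_eq_gcd_ab _ _
    refine mul_left_cancel₀ hk0 ?_
    simp only [Matrix.vec3_dotProduct, Matrix.cons_val_zero, Matrix.cons_val_one,
      Matrix.cons_val]
    linear_combination (-Int.gcdA (v 0) (v 1) * Int.gcdA g (v 2)) * h0 -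
      (Int.gcdB (v 0) (v 1) * Int.gcdA g (v 2)) * h1 - Int.gcdB g (v 2) * h2 -
      Int.gcdA g (v 2) * e1 - e2

theorem mem_integerSphere_iff {d : ℤ} {x : Fin 3 → ℤ} : x ∈ integerSphere d ↔ x ⬝ᵥ x = d := by
  simp [integerSphere, Matrix.vec3_dotProduct, sq]

theorem exists_dotProduct_eq_one_of_squarefree {d : ℤ} (hd : Squarefree d) {x : Fin 3 → ℤ}
    (hx : x ∈ integerSphere d) : ∃ y, x ⬝ᵥ y = 1 := by
  rw [mem_integerSphere_iff] at hx
  have hx0 : x ≠ 0 := by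
    rintro rfl
    exact hd.ne_zero (by simpa using hx.symm)
  obtain ⟨k, m, z, hk, rfl, hz⟩ := exists_pos_smul_dotProduct_eq_one hx0
  have hk1 : k = 1 := by
    have : IsUnit k := hd k ⟨m ⬝ᵥ m, by
      rw [← hx, smul_dotProduct, dotProduct_smul, smul_eq_mul, smul_eq_mul, mul_assoc]⟩
    obtain h | h := Int.isUnit_iff.1 this <;> omega
  exact ⟨z, by simp [hk1, hz]⟩

theorem det_vec3 (x y z : Fin 3 → ℤ) : Matrix.det ![x, y, z] =
    x 0 * y 1 * z 2 - x 0 * y 2 * z 1 - x 1 * y 0 * z 2 + x 1 * y 2 * z 0 + x 2 * y 0 * z 1 -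
      x 2 * y 1 * z 0 :=
  Matrix.det_fin_three _

/-- Write `x × x' = k m` with `m` primitive, and take `x·y = 1`, `m·z = 1`, `w = m × y`. The triple
product formula gives `k w = (x × x') × y = x' - (x'·y) x` and `det(x, w, z) = m·z = 1`. -/
theorem exists_basis_of_spherePairs {d e : ℤ} (hd : Squarefree d) (he : |e| < d)
    {p : (Fin 3 → ℤ) × (Fin 3 → ℤ)} (hp : p ∈ spherePairs d e) :
    ∃ (k h : ℤ) (w z : Fin 3 → ℤ), 0 < k ∧ p.2 = h • p.1 + k • w ∧
      Matrix.det ![p.1, w, z] = 1 := by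
  obtain ⟨x, x'⟩ := p
  obtain ⟨hx, hx', hxx⟩ := hp
  obtain ⟨y, hy⟩ := exists_dotProduct_eq_one_of_squarefree hd hx
  simp only [mem_integerSphere_iff] at hx hx' hxx ⊢
  have hn : x ⨯₃ x' ≠ 0 := by
    intro h
    -- Lagrange's identity: `|x × x'|² = d² - e² > 0`.
    have := cross_dot_cross x x' x x'
    rw [h, hx, hx', hxx, dotProduct_comm x' x, hxx, zero_dotProduct] at this
    obtain ⟨h1, h2⟩ := abs_lt.1 he
    nlinarith
  obtain ⟨k, m, z, hk, hm, hz⟩ := exists_pos_smul_dotProduct_eq_one hn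
  have hxm : x ⬝ᵥ m = 0 := by
    have := dot_self_cross x x'
    rw [hm, dotProduct_smul, smul_eq_mul] at this
    exact (mul_eq_zero.1 this).resolve_left hk.ne'
  have e0 := congrFun hm 0
  have e1 := congrFun hm 1
  have e2 := congrFun hm 2
  simp only [cross_apply, Matrix.cons_val_zero, Matrix.cons_val_one, Matrix.cons_val,
    Pi.smul_apply, smul_eq_mul] at e0 e1 e2
  rw [Matrix.vec3_dotProduct] at hy hz hxm
  refine ⟨k, x' ⬝ᵥ y, m ⨯₃ y, z, hk, ?_, ?_⟩
  · ext i
    fin_cases i <;> simp [cross_apply, Matrix.vec3_dotProduct]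
    · linear_combination (-x' 0) * hy + y 2 * e1 - y 1 * e2
    · linear_combination (-x' 1) * hy + y 0 * e2 - y 2 * e0
    · linear_combination (-x' 2) * hy + y 1 * e0 - y 0 * e1
  · rw [det_vec3]
    simp only [cross_apply, Matrix.cons_val_zero, Matrix.cons_val_one, Matrix.cons_val]
    linear_combination (m 0 * z 0 + m 1 * z 1 + m 2 * z 2) * hy + hz -
      (y 0 * z 0 + y 1 * z 1 + y 2 * z 2) * hxm

/-- The invariants `(k, f, n, a)` of a pair `p` of vectors in `ℤ³` with respect to an oriented
basis of `ℤ³`, the rows of `M`, whose first vector is `p.1` and whose first two vectors span a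
lattice containing `p.2`. -/
structure HasInvariants (p : (Fin 3 → ℤ) × (Fin 3 → ℤ)) (M : Matrix (Fin 3) (Fin 3) ℤ)
    (k f n a : ℤ) : Prop where
  det_eq : M.det = 1
  fst_eq : p.1 = M 0
  snd_eq : ∃ h : ℤ, p.2 = h • M 0 + k • M 1
  dot_one : M 0 ⬝ᵥ M 1 = f
  dot_two : M 0 ⬝ᵥ M 2 = a
  cofactor : (M 0 ⬝ᵥ M 0) * (M 1 ⬝ᵥ M 2) - f * a = n

theorem mul_transpose_self_eq {m n : Type*} [Fintype n] (M : Matrix m n ℤ) (i j : m) :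
    (M * Mᵀ) i j = M i ⬝ᵥ M j := rfl

theorem gram_det_eq {M : Matrix (Fin 3) (Fin 3) ℤ} (hM : M.det = 1) :
    (M 0 ⬝ᵥ M 0) * (M 1 ⬝ᵥ M 1) * (M 2 ⬝ᵥ M 2) +
      2 * (M 0 ⬝ᵥ M 1) * (M 1 ⬝ᵥ M 2) * (M 0 ⬝ᵥ M 2) - (M 0 ⬝ᵥ M 2) ^ 2 * (M 1 ⬝ᵥ M 1) -
      (M 0 ⬝ᵥ M 1) ^ 2 * (M 2 ⬝ᵥ M 2) - (M 1 ⬝ᵥ M 2) ^ 2 * (M 0 ⬝ᵥ M 0) = 1 := by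
  have h : (M * Mᵀ).det = 1 := by simp [hM]
  rw [Matrix.det_fin_three] at h
  simp only [mul_transpose_self_eq] at h
  rw [dotProduct_comm (M 1) (M 0), dotProduct_comm (M 2) (M 0), dotProduct_comm (M 2) (M 1)] at h
  linear_combination h

/-- The Gram determinant of `p`, in terms of that of the first two basis vectors. -/
theorem HasInvariants.sq_mul_eq {d e k f n a : ℤ} {p : (Fin 3 → ℤ) × (Fin 3 → ℤ)}
    {M : Matrix (Fin 3) (Fin 3) ℤ} (h : HasInvariants p M k f n a) (hp : p ∈ spherePairs d e) :
    M 0 ⬝ᵥ M 0 = d ∧ k ^ 2 * (d * (M 1 ⬝ᵥ M 1) - f ^ 2) = d ^ 2 - e ^ 2 ∧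
      ∀ l : ℤ, p.2 = l • M 0 + k • M 1 → e = l * d + k * f := by
  obtain ⟨h1, h2, h3⟩ := hp
  rw [mem_integerSphere_iff] at h1 h2
  rw [h.fst_eq] at h1 h3
  have hl : ∀ l : ℤ, p.2 = l • M 0 + k • M 1 → e = l * d + k * f := by
    intro l hl
    rw [← h3, hl, dotProduct_add, dotProduct_smul, dotProduct_smul, h1, h.dot_one, smul_eq_mul,
      smul_eq_mul]
  refine ⟨h1, ?_, hl⟩
  obtain ⟨l, hl'⟩ := h.snd_eq
  have he := hl l hl'
  rw [hl'] at h2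
  simp only [dotProduct_add, add_dotProduct, dotProduct_smul, smul_dotProduct, smul_eq_mul, h1,
    dotProduct_comm (M 1) (M 0), h.dot_one] at h2
  rw [he]
  linear_combination d * h2

/-- Given `d`, `f`, `a`, the relation for `k` yields `|w|²`, the cofactor `n` yields `w·z`, and Gram
determinant 1, linear in `|z|²` with coefficient `D ≠ 0`, yields `|z|²`. -/
theorem HasInvariants.gram_eq {d e k f n a : ℤ} (hk : k ≠ 0) (he : |e| < d)
    {p p' : (Fin 3 → ℤ) × (Fin 3 → ℤ)} {M M' : Matrix (Fin 3) (Fin 3) ℤ}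
    (h : HasInvariants p M k f n a) (h' : HasInvariants p' M' k f n a)
    (hp : p ∈ spherePairs d e) (hp' : p' ∈ spherePairs d e) : M * Mᵀ = M' * M'ᵀ := by
  obtain ⟨d1, D1, -⟩ := h.sq_mul_eq hp
  obtain ⟨d2, D2, -⟩ := h'.sq_mul_eq hp'
  have hd0 : d ≠ 0 := ((abs_nonneg e).trans_lt he).ne'
  have hD0 : d ^ 2 - e ^ 2 ≠ 0 := (sub_pos.2 (sq_lt_sq' (abs_lt.1 he).1 (abs_lt.1 he).2)).ne'
  have c1 := h.cofactor
  have c2 := h'.cofactor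
  rw [d1] at c1
  rw [d2] at c2
  have g : M 1 ⬝ᵥ M 1 = M' 1 ⬝ᵥ M' 1 := by
    refine mul_left_cancel₀ (mul_ne_zero (pow_ne_zero 2 hk) hd0) ?_
    linear_combination D1 - D2
  have b : M 1 ⬝ᵥ M 2 = M' 1 ⬝ᵥ M' 2 := mul_left_cancel₀ hd0 (by linear_combination c1 - c2)
  have c : M 2 ⬝ᵥ M 2 = M' 2 ⬝ᵥ M' 2 := by
    have e1 := gram_det_eq h.det_eq
    have e2 := gram_det_eq h'.det_eq
    rw [d1, h.dot_one, h.dot_two, g, b] at e1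
    rw [d2, h'.dot_one, h'.dot_two] at e2
    rw [← D2] at hD0
    exact mul_left_cancel₀ (right_ne_zero_of_mul hD0) (by linear_combination e1 - e2)
  ext i j
  simp only [mul_transpose_self_eq]
  fin_cases i <;> fin_cases j <;>
    simp [d1, d2, h.dot_one, h'.dot_one, h.dot_two, h'.dot_two, g, b, c,
      dotProduct_comm (M 1) (M 0), dotProduct_comm (M 2) (M 0), dotProduct_comm (M 2) (M 1),
      dotProduct_comm (M' 1) (M' 0), dotProduct_comm (M' 2) (M' 0), dotProduct_comm (M' 2) (M' 1)]

/-- The matrices with entries in `{-1, 0, 1}`. -/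
noncomputable def smallMatrices : Finset (Matrix (Fin 3) (Fin 3) ℤ) :=
  (Fintype.piFinset fun _ => Fintype.piFinset fun _ => Finset.Icc (-1) 1).map
    Matrix.of.toEmbedding

theorem card_smallMatrices : smallMatrices.card = 3 ^ 9 := by
  simp [smallMatrices, Fintype.card_piFinset]

theorem mem_smallMatrices_of_mul_transpose_eq_one {T : Matrix (Fin 3) (Fin 3) ℤ}
    (hT : T * Tᵀ = 1) : T ∈ smallMatrices := by
  rw [smallMatrices, Finset.mem_map]
  refine ⟨Matrix.of.symm T, ?_, Matrix.of.apply_symm_apply T⟩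
  rw [Fintype.mem_piFinset]
  intro i
  rw [Fintype.mem_piFinset]
  intro j
  rw [Finset.mem_Icc, Matrix.of_symm_apply]
  have h : T i ⬝ᵥ T i = 1 := by rw [← mul_transpose_self_eq, hT, Matrix.one_apply_eq]
  have h2 : T i j * T i j ≤ 1 := by
    rw [← h]
    exact Finset.single_le_sum (f := fun j => T i j * T i j) (fun _ _ => mul_self_nonneg _)
      (Finset.mem_univ j)
  constructor <;> nlinarith

/-- Two pairs with the same invariants differ by an integral orthogonal matrix. -/
theorem HasInvariants.exists_smallMatrix {d e k f n a : ℤ} (hk : k ≠ 0) (he : |e| < d)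
    {p p' : (Fin 3 → ℤ) × (Fin 3 → ℤ)} {M M' : Matrix (Fin 3) (Fin 3) ℤ}
    (h : HasInvariants p M k f n a) (h' : HasInvariants p' M' k f n a)
    (hp : p ∈ spherePairs d e) (hp' : p' ∈ spherePairs d e) :
    ∃ T ∈ smallMatrices, p' = (p.1 ᵥ* T, p.2 ᵥ* T) := by
  have hG := h.gram_eq hk he h' hp hp'
  have hMa : M * M.adjugate = 1 := by rw [Matrix.mul_adjugate, h.det_eq, one_smul]
  have haM : M.adjugate * M = 1 := by rw [Matrix.adjugate_mul, h.det_eq, one_smul]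
  -- Since `M` has determinant 1, this is `M⁻¹ M'`, orthogonal because the Gram matrices agree.
  refine ⟨M.adjugate * M', mem_smallMatrices_of_mul_transpose_eq_one ?_, ?_⟩
  · calc _ = M.adjugate * (M' * M'ᵀ) * M.adjugateᵀ := by
          simp only [Matrix.transpose_mul, Matrix.mul_assoc]
      _ = (M.adjugate * M) * (M.adjugate * M)ᵀ := by
          rw [← hG]; simp only [Matrix.transpose_mul, Matrix.mul_assoc]
      _ = 1 := by simp [haM]
  · have hrow (i : Fin 3) : M i ᵥ* (M.adjugate * M') = M' i := by
      have : M * (M.adjugate * M') = M' := by rw [← Matrix.mul_assoc, hMa, Matrix.one_mul]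
      conv_rhs => rw [← this]
      rfl
    obtain ⟨l, hl⟩ := h.snd_eq
    obtain ⟨l', hl'⟩ := h'.snd_eq
    have e1 := (h.sq_mul_eq hp).2.2 l hl
    have e2 := (h'.sq_mul_eq hp').2.2 l' hl'
    have hd0 : d ≠ 0 := ((abs_nonneg e).trans_lt he).ne'
    -- The coefficient `l` need not be an invariant: `e = l d + k f` determines it.
    have hll : l = l' := mul_right_cancel₀ hd0 (by linear_combination e2 - e1)
    ext1
    · rw [h.fst_eq, h'.fst_eq, hrow]
    · rw [hl, hl', Matrix.add_vecMul, Matrix.smul_vecMul, Matrix.smul_vecMul, hrow, hrow, hll]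

theorem exists_hasInvariants {d e : ℤ} (hd : Squarefree d) (he : |e| < d)
    {p : (Fin 3 → ℤ) × (Fin 3 → ℤ)} (hp : p ∈ spherePairs d e) :
    ∃ (M : Matrix (Fin 3) (Fin 3) ℤ) (k f n a D : ℤ), HasInvariants p M k f n a ∧ 0 < k ∧
      k ^ 2 * D = d ^ 2 - e ^ 2 ∧ f ∈ sqrtsOfNeg d D ∧ n ∈ sqrtsOfNeg D d ∧
      a ∈ sqrtsOfNeg d ((n ^ 2 + d) / D) := by
  obtain ⟨k, h, w₀, z₀, hk, hp2, hdet⟩ := exists_basis_of_spherePairs hd he hp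
  obtain ⟨x, x'⟩ := p
  have hd0 : 0 < d := (abs_nonneg e).trans_lt he
  have hxx : x ⬝ᵥ x = d := mem_integerSphere_iff.1 hp.1
  have hD0 : 0 < d ^ 2 - e ^ 2 := sub_pos.2 (sq_lt_sq' (abs_lt.1 he).1 (abs_lt.1 he).2)
  simp only at hp2 hdet
  obtain ⟨w, hw⟩ : ∃ w, w = w₀ - ((x ⬝ᵥ w₀) / d) • x := ⟨_, rfl⟩
  have hf : x ⬝ᵥ w = (x ⬝ᵥ w₀) % d := by
    rw [hw, dotProduct_sub, dotProduct_smul, hxx, smul_eq_mul, Int.emod_def, mul_comm]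
  set f := x ⬝ᵥ w with hfdef
  set D := d * (w ⬝ᵥ w) - f ^ 2 with hD
  set n₀ := d * (w ⬝ᵥ z₀) - f * (x ⬝ᵥ z₀) with hn₀
  -- Subtracting `w` from `z` lowers `n` by `D`; subtracting `x` afterwards lowers `a` by `d` and
  -- leaves `n` unchanged.
  obtain ⟨z₁, hz₁⟩ : ∃ z₁, z₁ = z₀ - (n₀ / D) • w := ⟨_, rfl⟩
  obtain ⟨z, hz⟩ : ∃ z, z = z₁ - ((x ⬝ᵥ z₁) / d) • x := ⟨_, rfl⟩
  have ha : x ⬝ᵥ z = (x ⬝ᵥ z₁) % d := by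
    rw [hz, dotProduct_sub, dotProduct_smul, hxx, smul_eq_mul, Int.emod_def, mul_comm]
  have hn : d * (w ⬝ᵥ z) - f * (x ⬝ᵥ z) = n₀ % D := by
    rw [hz, hz₁, Int.emod_def]
    simp only [dotProduct_sub, dotProduct_smul, hxx, smul_eq_mul, dotProduct_comm w x, ← hfdef]
    rw [hn₀, hD]
    ring
  set M : Matrix (Fin 3) (Fin 3) ℤ := ![x, w, z] with hM
  have hM0 : M 0 = x := rfl
  have hM1 : M 1 = w := rfl
  have hM2 : M 2 = z := rfl
  have hI : HasInvariants (x, x') M k f (d * (w ⬝ᵥ z) - f * (x ⬝ᵥ z)) (x ⬝ᵥ z) := by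
    refine ⟨?_, rfl, ⟨h + k * ((x ⬝ᵥ w₀) / d), ?_⟩, rfl, rfl, ?_⟩
    · rw [← hdet, hM, det_vec3, det_vec3, hz]
      generalize (x ⬝ᵥ z₁) / d = s
      rw [hz₁]
      generalize n₀ / D = t
      rw [hw]
      simp only [Pi.sub_apply, Pi.smul_apply, smul_eq_mul]
      ring
    · simp only [hp2, hM0, hM1, hw]
      module
    · rw [hM0, hM1, hM2, hxx]
  have hk2 := (hI.sq_mul_eq hp).2.1
  rw [hM1, ← hD] at hk2
  have hDpos : 0 < D := pos_of_mul_pos_right (hk2 ▸ hD0) (sq_nonneg k)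
  have hG := gram_det_eq hI.det_eq
  rw [hM0, hM1, hM2, hxx, ← hfdef] at hG
  have hE : (d * (w ⬝ᵥ z) - f * (x ⬝ᵥ z)) ^ 2 + d = D * (d * (z ⬝ᵥ z) - (x ⬝ᵥ z) ^ 2) := by
    rw [hD]
    linear_combination (-d) * hG
  refine ⟨M, k, f, _, _, D, hI, hk, hk2, ?_, ?_, ?_⟩ <;> rw [mem_sqrtsOfNeg]
  · refine ⟨?_, ⟨w ⬝ᵥ w, by rw [hD]; ring⟩⟩
    rw [hf]
    exact ⟨Int.emod_nonneg _ hd0.ne', Int.emod_lt_of_pos _ hd0⟩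
  · refine ⟨?_, ⟨_, hE⟩⟩
    rw [hn]
    exact ⟨Int.emod_nonneg _ hDpos.ne', Int.emod_lt_of_pos _ hDpos⟩
  · constructor
    · rw [ha]
      exact ⟨Int.emod_nonneg _ hd0.ne', Int.emod_lt_of_pos _ hd0⟩
    · rw [hE, Int.mul_ediv_cancel_left _ hDpos.ne']
      exact ⟨z ⬝ᵥ z, by ring⟩

/-! ### Representations of binary forms -/

theorem binaryForm_apply (a b c : ℤ) (v : Fin 2 → ℤ) :
    binaryForm a b c v = a * v 0 ^ 2 + b * (v 0 * v 1) + c * v 1 ^ 2 := by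
  simp [binaryForm, sq]

theorem sumThreeSquares_apply (v : Fin 3 → ℤ) : sumThreeSquares v = v ⬝ᵥ v := by
  simp [sumThreeSquares, Matrix.vec3_dotProduct]

theorem sumThreeSquares_lineMap (x y : Fin 3 → ℤ) (s t : ℤ) :
    sumThreeSquares (s • x + t • y) =
      (x ⬝ᵥ x) * s ^ 2 + 2 * (x ⬝ᵥ y) * (s * t) + (y ⬝ᵥ y) * t ^ 2 := by
  simp only [sumThreeSquares_apply, dotProduct_add, add_dotProduct, dotProduct_smul,
    smul_dotProduct, smul_eq_mul, dotProduct_comm y x]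
  ring

/-- Representations of `d x² + 2 e x y + d y²` by the sum of three squares correspond to pairs of
vectors on the sphere with dot product `e`. -/
def formRepresentationEquiv (d e : ℤ) :
    FormRepresentation (binaryForm d (2 * e) d) sumThreeSquares ≃ spherePairs d e where
  toFun φ := ⟨(φ (Pi.single 0 1), φ (Pi.single 1 1)), by
    have h0 := φ.map_app (Pi.single 0 1)
    have h1 := φ.map_app (Pi.single 1 1)
    -- Polarization: the value at the sum of the basis vectors recovers the dot product.
    have h2 := φ.map_app (Pi.single 0 1 + Pi.single 1 1)
    rw [map_add] at h2
    have h3 := sumThreeSquares_lineMap (φ (Pi.single 0 1)) (φ (Pi.single 1 1)) 1 1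
    simp only [one_smul] at h3
    rw [h3, binaryForm_apply] at h2
    rw [sumThreeSquares_apply, binaryForm_apply] at h0 h1
    simp at h0 h1 h2
    refine ⟨mem_integerSphere_iff.2 h0, mem_integerSphere_iff.2 h1, ?_⟩
    simp only
    linarith⟩
  invFun p :=
    { toLinearMap := (LinearMap.proj 0).smulRight p.1.1 + (LinearMap.proj 1).smulRight p.1.2
      map_app' := fun v => by
        obtain ⟨⟨x, y⟩, hx, hy, hxy⟩ := p
        rw [mem_integerSphere_iff] at hx hy
        simp only at hx hy hxy
        change sumThreeSquares (v 0 • x + v 1 • y) = _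
        rw [sumThreeSquares_lineMap, binaryForm_apply, hx, hy, hxy] }
  left_inv φ := by
    ext v i
    have hv : v = v 0 • Pi.single 0 1 + v 1 • Pi.single 1 1 := by
      ext j
      fin_cases j <;> simp
    conv_rhs => rw [hv, map_add, map_smul, map_smul]
    rfl
  right_inv p := by
    obtain ⟨⟨x, y⟩, hp⟩ := p
    ext i
    · change ((Pi.single 0 1 : Fin 2 → ℤ) 0 • x + (Pi.single 0 1 : Fin 2 → ℤ) 1 • y) i = x i
      simp
    · change ((Pi.single 1 1 : Fin 2 → ℤ) 0 • x + (Pi.single 1 1 : Fin 2 → ℤ) 1 • y) i = y i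
      simp

/-! ### Counting -/

theorem finite_integerSphere (d : ℤ) : (integerSphere d).Finite := by
  refine (Set.finite_Icc (fun _ => -|d|) (fun _ => |d|)).subset fun x hx => ?_
  have h : ∀ i, |x i| ≤ |d| := fun i => by
    rw [mem_integerSphere_iff] at hx
    have h2 : x i * x i ≤ d := by
      rw [← hx]
      exact Finset.single_le_sum (f := fun j => x j * x j) (fun _ _ => mul_self_nonneg _)
        (Finset.mem_univ i)
    have h3 : |x i| ≤ |x i| * |x i| := by
      rcases (abs_nonneg (x i)).eq_or_lt with h | h
      · simp [← h]
      · nlinarith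
    rw [abs_mul_abs_self] at h3
    exact (h3.trans h2).trans (le_abs_self d)
  exact ⟨fun i => (abs_le.1 (h i)).1, fun i => (abs_le.1 (h i)).2⟩

theorem finite_spherePairs (d e : ℤ) : (spherePairs d e).Finite :=
  ((finite_integerSphere d).prod (finite_integerSphere d)).subset fun _ hp => ⟨hp.1, hp.2.1⟩

/-- A finite set containing all reduced invariants `(k, f, n, a)`. -/
noncomputable def reducedInvariants (d e : ℤ) : Finset (ℕ × ℤ × ℤ × ℤ) :=
  ((d ^ 2 - e ^ 2).natAbs.divisors.filter fun k : ℕ => (k : ℤ) ^ 2 ∣ d ^ 2 - e ^ 2).biUnion fun k =>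
    (sqrtsOfNeg d ((d ^ 2 - e ^ 2) / k ^ 2)).biUnion fun f =>
      (sqrtsOfNeg ((d ^ 2 - e ^ 2) / k ^ 2) d).biUnion fun n =>
        (sqrtsOfNeg d ((n ^ 2 + d) / ((d ^ 2 - e ^ 2) / k ^ 2))).image fun a => (k, f, n, a)

/-- For `f` and `a` the modulus `d` is squarefree; for `n` the modulus `D` need not be, but `d` is
then the constant term, which suffices for `card_sqrtsOfNeg_le`. -/
theorem card_reducedInvariants_le {d e : ℤ} (hd : Squarefree d) (he : |e| < d) :
    (reducedInvariants d e).card ≤ (d ^ 2 - e ^ 2).natAbs.divisors.card *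
      ((2 * d.natAbs.divisors.card) * ((2 * (d ^ 2 - e ^ 2).natAbs.divisors.card) *
        (2 * d.natAbs.divisors.card))) := by
  have hd0 : 0 < d := (abs_nonneg e).trans_lt he
  have hD0 : 0 < d ^ 2 - e ^ 2 := sub_pos.2 (sq_lt_sq' (abs_lt.1 he).1 (abs_lt.1 he).2)
  have hsq : ∀ c : ℤ, c ^ 2 ∣ d → IsUnit c := fun c hc => hd c (by rwa [← sq])
  refine (Finset.card_biUnion_le_card_mul _ _ _ fun k hk => ?_).trans
    (Nat.mul_le_mul_right _ (Finset.card_filter_le _ _))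
  obtain ⟨D, hD⟩ := (Finset.mem_filter.1 hk).2
  have hk0 : (k : ℤ) ^ 2 ≠ 0 := fun h => hD0.ne' (by rw [hD, h, zero_mul])
  have hDk : (d ^ 2 - e ^ 2) / (k : ℤ) ^ 2 = D := by rw [hD, Int.mul_ediv_cancel_left _ hk0]
  have hDpos : 0 < D := pos_of_mul_pos_right (hD ▸ hD0) (sq_nonneg (k : ℤ))
  rw [hDk]
  refine (Finset.card_biUnion_le_card_mul _ _ _ fun f _ => ?_).trans
    (Nat.mul_le_mul_right _ (card_sqrtsOfNeg_le hd0 fun c hc _ => hsq c hc))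
  refine (Finset.card_biUnion_le_card_mul _ _ _ fun n _ => ?_).trans
    (Nat.mul_le_mul_right _ ((card_sqrtsOfNeg_le hDpos fun c _ hc => hsq c hc).trans
      (Nat.mul_le_mul_left _ (Finset.card_le_card (Nat.divisors_subset_of_dvd ?_ ?_)))))
  · exact Finset.card_image_le.trans (card_sqrtsOfNeg_le hd0 fun c hc _ => hsq c hc)
  · exact Int.natAbs_ne_zero.2 hD0.ne'
  · exact Int.natAbs_dvd_natAbs.2 (hD ▸ Dvd.intro_left _ rfl)

theorem exists_mem_reducedInvariants {d e : ℤ} (hd : Squarefree d) (he : |e| < d)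
    {p : (Fin 3 → ℤ) × (Fin 3 → ℤ)} (hp : p ∈ spherePairs d e) :
    ∃ q ∈ reducedInvariants d e, q.1 ≠ 0 ∧
      ∃ M, HasInvariants p M q.1 q.2.1 q.2.2.1 q.2.2.2 := by
  obtain ⟨M, k, f, n, a, D, hI, hk, hD, hf, hn, ha⟩ := exists_hasInvariants hd he hp
  lift k to ℕ using hk.le
  have hD0 : 0 < d ^ 2 - e ^ 2 := sub_pos.2 (sq_lt_sq' (abs_lt.1 he).1 (abs_lt.1 he).2)
  have hDk : (d ^ 2 - e ^ 2) / (k : ℤ) ^ 2 = D := by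
    rw [← hD, Int.mul_ediv_cancel_left _ (pow_ne_zero 2 hk.ne')]
  refine ⟨(k, f, n, a), ?_, by simpa using hk.ne', M, hI⟩
  simp only [reducedInvariants, Finset.mem_biUnion, Finset.mem_image, Finset.mem_filter]
  refine ⟨k, ⟨Nat.mem_divisors.2 ⟨?_, Int.natAbs_ne_zero.2 hD0.ne'⟩, Dvd.intro _ hD⟩, f, ?_, n, ?_,
    a, ?_, rfl⟩
  · rw [← Int.natAbs_natCast k, Int.natAbs_dvd_natAbs, ← hD]
    exact (dvd_pow_self _ two_ne_zero).mul_right _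
  all_goals rwa [hDk]

theorem ncard_spherePairs_le {d e : ℤ} (hd : Squarefree d) (he : |e| < d) :
    (spherePairs d e).ncard ≤ 3 ^ 9 * (reducedInvariants d e).card := by
  classical
  rw [Set.ncard_eq_toFinset_card _ (finite_spherePairs d e)]
  choose! q hq hq0 M hM using fun p => exists_mem_reducedInvariants (p := p) hd he
  refine Finset.card_le_mul_card_image_of_maps_to (f := q)
    (fun p hp => hq p (by simpa using hp)) _ fun b _ => ?_
  rcases Finset.eq_empty_or_nonempty
    {p ∈ (finite_spherePairs d e).toFinset | q p = b} with h | ⟨p, hp⟩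
  · simp [h]
  · simp only [Finset.mem_filter, Set.Finite.mem_toFinset] at hp
    rw [← card_smallMatrices]
    refine (Finset.card_le_card fun p' hp' => ?_).trans
      (Finset.card_image_le (f := fun T => (p.1 ᵥ* T, p.2 ᵥ* T)))
    simp only [Finset.mem_filter, Set.Finite.mem_toFinset] at hp'
    have h1 := hM p hp.1
    have h2 := hM p' hp'.1
    rw [hp'.2, ← hp.2] at h2
    obtain ⟨T, hT, h⟩ := h1.exists_smallMatrix (by exact_mod_cast hq0 p hp.1) he h2 hp.1 hp'.1
    exact Finset.mem_image.2 ⟨T, hT, h.symm⟩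

theorem exists_ncard_spherePairs_le (ε : ℝ) (hε : 0 < ε) :
    ∃ C : ℝ, 0 < C ∧ ∀ d e : ℤ, Squarefree d → |e| < d →
      ((spherePairs d e).ncard : ℝ) ≤ C * (d : ℝ) ^ ε := by
  -- Two divisor counts of `d` and two of `d² - e² ≤ d²` give total exponent `1 + 1 + 2 + 2 = 6`.
  obtain ⟨C, hC, h⟩ := Nat.exists_card_divisors_le_mul_rpow (ε / 6) (by positivity)
  refine ⟨3 ^ 9 * 8 * C ^ 4, by positivity, fun d e hd he => ?_⟩
  have hd0 : 0 < d := (abs_nonneg e).trans_lt he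
  have hdR : (0 : ℝ) < d := by exact_mod_cast hd0
  have hD0 : 0 < d ^ 2 - e ^ 2 := sub_pos.2 (sq_lt_sq' (abs_lt.1 he).1 (abs_lt.1 he).2)
  have h1 := h d.natAbs (Int.natAbs_ne_zero.2 hd0.ne')
  have h2 := h (d ^ 2 - e ^ 2).natAbs (Int.natAbs_ne_zero.2 hD0.ne')
  rw [Nat.cast_natAbs, abs_of_pos hd0] at h1
  rw [Nat.cast_natAbs, abs_of_pos hD0] at h2
  set s : ℝ := (d : ℝ) ^ (ε / 6) with hs
  have hD : ((d ^ 2 - e ^ 2 : ℤ) : ℝ) ^ (ε / 6) ≤ s ^ 2 := by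
    rw [hs, ← Real.rpow_mul_natCast hdR.le, mul_comm (ε / 6), Real.rpow_natCast_mul hdR.le]
    refine Real.rpow_le_rpow (by exact_mod_cast hD0.le) ?_ (by positivity)
    push_cast
    linarith [sq_nonneg (e : ℝ)]
  have h2' := h2.trans (mul_le_mul_of_nonneg_left hD (by positivity))
  have hcard := (ncard_spherePairs_le hd he).trans
    (Nat.mul_le_mul_left _ (card_reducedInvariants_le hd he))
  have hs6 : s ^ 6 = (d : ℝ) ^ ε := by
    rw [hs, ← Real.rpow_mul_natCast hdR.le]
    congr 1
    push_cast
    ring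
  have hs0 : 0 ≤ s := by positivity
  calc ((spherePairs d e).ncard : ℝ)
      ≤ 3 ^ 9 * ((d ^ 2 - e ^ 2).natAbs.divisors.card * ((2 * d.natAbs.divisors.card) *
        ((2 * (d ^ 2 - e ^ 2).natAbs.divisors.card) * (2 * d.natAbs.divisors.card)))) := by
        exact_mod_cast hcard
    _ ≤ 3 ^ 9 * ((C * s ^ 2) * ((2 * (C * s)) * ((2 * (C * s ^ 2)) * (2 * (C * s))))) := by
        gcongr
    _ = 3 ^ 9 * 8 * C ^ 4 * s ^ 6 := by ring
    _ = _ := by rw [hs6]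

theorem mainTheorem5 (ε : ℝ) (hε : 0 < ε) :
    ∃ C : ℝ, 0 < C ∧ ∀ d e : ℤ, Squarefree d → |e| < d →
      (spherePairs d e).Finite ∧
      ((spherePairs d e).ncard : ℝ) ≤ C * (d : ℝ) ^ ε ∧
      Finite (FormRepresentation (binaryForm d (2 * e) d) sumThreeSquares) ∧
      (Nat.card (FormRepresentation (binaryForm d (2 * e) d) sumThreeSquares) : ℝ)
        ≤ C * (d : ℝ) ^ ε ∧
      Nat.card (FormRepresentation (binaryForm d (2 * e) d) sumThreeSquares)
        = (spherePairs d e).ncard := by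
  obtain ⟨C, hC, h⟩ := exists_ncard_spherePairs_le ε hε
  refine ⟨C, hC, fun d e hd he => ?_⟩
  have hfin := finite_spherePairs d e
  have hcard : Nat.card (FormRepresentation (binaryForm d (2 * e) d) sumThreeSquares) =
      (spherePairs d e).ncard := Nat.card_congr (formRepresentationEquiv d e)
  have : Finite (spherePairs d e) := hfin
  exact ⟨hfin, h d e hd he, Finite.of_equiv _ (formRepresentationEquiv d e).symm,
    hcard ▸ h d e hd he, hcard⟩
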